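/- **Theorem.** Let $N$ be a finite set of items with sizes $s(i)\in\mathbb{R}_{>0}$, and let $f:2^N\to\mathbb{R}_{\ge 0}$ be normalized ($f(\emptyset)=0$), monotone and submodular. Write $s(A)=\sum_{i\in A}s(i)$. Fix a linear order on $N$; below, every $\arg\max$ breaks ties in favour of the item that comes first in this order (if there are no ties, the order plays no role). For $G\subseteq N$, the density of $i$ with respect to $G$ is $\bigl(f(G\cup\{i\})-f(G)\bigr)/s(i)$. For $M\subseteq N$ and $\gamma>0$, the greedy order of $M$ for $\gamma$ is the order $i_1,i_2,\dots$ of the items of $\{i\in M: s(i)\le\gamma\}$ in which $i_j$ is the remaining item of maximum density with respect to $G_{j-1}=\{i_1,\dots,i_{j-1}\}$. *AGreedy* (known capacity $C$). Take the greedy order of $N$ for $C$ and let $G_k$ be its longest prefix of consecutive items with $s(G_k)\le C$. If it contains all items of size at most $C$, return $G_k$. Otherwise return $G_k$ if $f(G_k)\ge f(G_k\cup\{i_{k+1}\})-f(G_k)$, and $\{i_{k+1}\}$ if not. Let $\mathrm{AG}(C)$ be the returned set. *Indispensability test* for $M\subseteq N$ and $x\in M$. Build the greedy order of $M$ for the capacity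 $s(x)$ as long as the set $G_{j-1}$ of items chosen so far has $s(G_{j-1})\le s(x)$, until $x=i_j$ is chosen. If $x$ is chosen in this way with $j\ge 2$ and $f(G_{j-1}\cup\{x\})-f(G_{j-1})>f(G_{j-1})$, then $x$ is declared indispensable in $M$, and the test returns the list $i_1,\dots,i_{j-1}$; in all other cases $x$ is declared not indispensable and the test returns the empty list. *List of start items.* Start with the empty list $F$ and go through the items $i$ of $N$ sorted non-decreasingly by size. Put $i$ at the front of $F$ if $i$ is declared indispensable in $N$, or if $F$ is nonempty and $i=\arg\max\{f(\{j\})/s(j) : j\in N,\ s(j)\le s(i)\}$. *Policies.* A policy is a binary decision tree whose inner nodes are items, with no item appearing twice on a path from the root to a leaf. It is executed for a capacity $C$ as follows: attempt to pack the item at the current node; if its size is at most the remaining capacity, it is packed, the remaining capacity is reduced by its size, and the execution continues in the first subtree; otherwise it is discarded and the execution continues in the second subtree; at a leaf the execution ends. In particular the tree does not depend on $C$. *Robust policy* $\Pi$. Start with $S=\emptyset$ (packed items) and $M=N$ (available items). 1. Go through the list $F$ of start items from its front until one of them is packed: attempt the item $x$. If it fits, let $L$ be the list returned by the indispensability test for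 $M$ and $x$, and set $S=\{x\}$ and $M\leftarrow M\setminus\{x\}$. If it does not fit, replace $M$ by $\{i\in M: s(i)<s(x)\}$. If no start item fits, let $L$ be empty. 2. Attempt the items of $L$ one after the other, adding each one that fits to $S$ and removing each one from $M$. 3. While $M\ne\emptyset$, attempt the item $i\in M$ of maximum density with respect to $S$. If it fits, add it to $S$ and remove it from $M$; otherwise replace $M$ by $\{j\in M: s(j)<s(i)\}$. Let $\Pi(C)$ be the set of items packed by $\Pi$ when the capacity is $C$. Then $$f(\Pi(C))\ \ge\ f(\mathrm{AG}(C))\qquad\text{for every capacity } C\in\mathbb{R}_{>0}.$$ -/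

import Mathlib

open Finset

noncomputable section

namespace Knapsack

variable {ι : Type*} [LinearOrder ι]

/-- `A ↦ f A` is submodular. -/
def IsSubmodular (f : Finset ι → ℝ) : Prop :=
  ∀ A B : Finset ι, f (A ∪ B) + f (A ∩ B) ≤ f A + f B

/-- The size of a set of items. -/
def size {ι : Type*} (s : ι → ℝ) (A : Finset ι) : ℝ := ∑ i ∈ A, s i

/-- The density of item `i` with respect to the set `G` that is already packed. -/
def density (f : Finset ι → ℝ) (s : ι → ℝ) (G : Finset ι) (i : ι) : ℝ :=
  (f (insert i G) - f G) / s i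

/-- The items of `U` at which `g` is maximal over `U`. -/
def maximizers {ι : Type*} (g : ι → ℝ) (U : Finset ι) : Finset ι :=
  U.filter fun i => ∀ j ∈ U, g j ≤ g i

theorem maximizers_nonempty {ι : Type*} (g : ι → ℝ) {U : Finset ι} (h : U.Nonempty) :
    (maximizers g U).Nonempty := by
  obtain ⟨i, hi, hmax⟩ := U.exists_max_image g h
  exact ⟨i, mem_filter.2 ⟨hi, hmax⟩⟩

/-- `arg max` of `g` over the nonempty set `U`; ties are broken in favour of the item that comes
first in the fixed linear order on the items. -/
def argmax (g : ι → ℝ) (U : Finset ι) (h : U.Nonempty) : ι :=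
  (maximizers g U).min' (maximizers_nonempty g h)

theorem argmax_mem (g : ι → ℝ) (U : Finset ι) (h : U.Nonempty) : argmax g U h ∈ U :=
  (mem_filter.1 ((maximizers g U).min'_mem (maximizers_nonempty g h))).1

/-! ### The greedy algorithm for a known capacity -/

/-- The loop of the greedy algorithm, started with the packed set `G` and the remaining items `U`.
It returns `G_k`, together with `i_{k+1}` if the loop was left because `i_{k+1}` did not fit, and
together with `none` if it was left because `U` became empty. -/
def greedyLoop (f : Finset ι → ℝ) (s : ι → ℝ) (γ : ℝ) (G U : Finset ι) :
    Finset ι × Option ι :=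
  if h : U.Nonempty then
    if size s (insert (argmax (density f s G) U h) G) ≤ γ then
      greedyLoop f s γ (insert (argmax (density f s G) U h) G)
        (U.erase (argmax (density f s G) U h))
    else (G, some (argmax (density f s G) U h))
  else (G, none)
termination_by U.card
decreasing_by exact card_erase_lt_of_mem (argmax_mem _ _ _)

/-- The output of the alternative greedy algorithm on the item set `N` for the capacity `γ`. -/
def aGreedy (f : Finset ι → ℝ) (s : ι → ℝ) (N : Finset ι) (γ : ℝ) : Finset ι :=
  match greedyLoop f s γ ∅ (N.filter fun i => s i ≤ γ) with
  | (G, none) => G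
  | (G, some i) => if f (insert i G) - f G ≤ f G then G else {i}

/-! ### Indispensable items and the list of start items -/

/-- The loop that decides whether `x` is indispensable. The list `L` holds the items chosen so far,
in the order of their choice, and `U` the items that are left. (`U` is never empty when the loop is
entered if `x` belongs to it at the start.) -/
def indispensableLoop (f : Finset ι → ℝ) (s : ι → ℝ) (x : ι) (L : List ι) (U : Finset ι) :
    Bool × List ι :=
  if h : U.Nonempty then
    if size s L.toFinset ≤ s x then
      if argmax (density f s L.toFinset) U h = x then
        if L ≠ [] ∧ f L.toFinset < f (insert x L.toFinset) - f L.toFinset then (true, L)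
        else (false, [])
      else
        indispensableLoop f s x (L ++ [argmax (density f s L.toFinset) U h])
          (U.erase (argmax (density f s L.toFinset) U h))
    else (false, [])
  else (false, [])
termination_by U.card
decreasing_by exact card_erase_lt_of_mem (argmax_mem _ _ _)

/-- Decides whether item `x` is indispensable in `N`; if so, the second component lists, in greedy
order, the items in front of `x` in the greedy order for the capacity `s x`, and otherwise it is
empty. -/
def isIndispensable (f : Finset ι → ℝ) (s : ι → ℝ) (N : Finset ι) (x : ι) : Bool × List ι :=
  indispensableLoop f s x [] (N.filter fun i => s i ≤ s x)

/-- `x` is the first item in the greedy order of `N` for the capacity `s x`. -/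
def IsFirstItem (f : Finset ι → ℝ) (s : ι → ℝ) (N : Finset ι) (x : ι) : Prop :=
  ∃ h : (N.filter fun i => s i ≤ s x).Nonempty,
    argmax (fun i => f {i} / s i) (N.filter fun i => s i ≤ s x) h = x

/-- The items of `N` sorted non-decreasingly by size. -/
def sortedBySize (s : ι → ℝ) (N : Finset ι) : List ι :=
  (N.sort (· ≤ ·)).insertionSort fun i j => s i ≤ s j

open Classical in
/-- The body of the loop that builds the list of start items: item `i` is considered for the list
`F` built so far. -/
def addStartItem (f : Finset ι → ℝ) (s : ι → ℝ) (N : Finset ι) (F : List ι) (i : ι) : List ι :=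
  if (isIndispensable f s N i).1 = true then i :: F
  else if IsFirstItem f s N i ∧ F ≠ [] then i :: F
  else F

/-- The list of start items: the items are considered non-decreasingly by size, and added at the
front of the list. -/
def startItemList (f : Finset ι → ℝ) (s : ι → ℝ) (N : Finset ι) : List ι :=
  (sortedBySize s N).foldl (addStartItem f s N) []

/-! ### Packing policies -/

/-- A binary decision tree: at a node the policy attempts to pack the item of the node, and proceeds
with the first subtree if it fits and with the second one if it does not. -/
inductive DecisionTree (ι : Type*) where
  | leaf : DecisionTree ι
  | attempt (i : ι) (ifFits ifNot : DecisionTree ι) : DecisionTree ι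

/-- No item appears twice on a path from the root to a leaf, and none of the items in `X` appears. -/
def DecisionTree.NoRepeat : DecisionTree ι → Finset ι → Prop
  | .leaf, _ => True
  | .attempt i t u, X => i ∉ X ∧ t.NoRepeat (insert i X) ∧ u.NoRepeat (insert i X)

/-- The set of items packed when the remaining capacity is `c`. -/
def DecisionTree.pack (s : ι → ℝ) : DecisionTree ι → ℝ → Finset ι
  | .leaf, _ => ∅
  | .attempt i t u, c => if s i ≤ c then insert i (t.pack s (c - s i)) else u.pack s c

/-- A policy is a binary decision tree in which no item appears more than once on a path from the
root to a leaf. In particular it does not depend on the capacity. -/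
structure Policy (ι : Type*) [LinearOrder ι] where
  /-- the underlying decision tree -/
  tree : DecisionTree ι
  noRepeat : tree.NoRepeat ∅

/-- The set `Π(C)` of items packed by the policy `Π` when the capacity is `C`. -/
def Policy.pack (s : ι → ℝ) (P : Policy ι) (C : ℝ) : Finset ι := P.tree.pack s C

/-! ### The robust policy

In the three steps below, `S` is the set of items packed so far and `N` the set of items that are
still available. -/

/-- Step 3: try to pack the items of `N` in greedy order; when an item does not fit, it is discarded
together with all items of at least the same size. -/
def packGreedily (f : Finset ι → ℝ) (s : ι → ℝ) (S N : Finset ι) : DecisionTree ι :=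
  if h : N.Nonempty then
    .attempt (argmax (density f s S) N h)
      (packGreedily f s (insert (argmax (density f s S) N h) S)
        (N.erase (argmax (density f s S) N h)))
      (packGreedily f s S (N.filter fun i => s i < s (argmax (density f s S) N h)))
  else .leaf
termination_by N.card
decreasing_by
  · exact card_erase_lt_of_mem (argmax_mem _ _ _)
  · exact card_lt_card (filter_ssubset.2 ⟨_, argmax_mem _ _ _, lt_irrefl _⟩)

/-- Step 2: try to pack the items of the list, one after the other, and continue with Step 3. -/
def packList (f : Finset ι → ℝ) (s : ι → ℝ) : List ι → Finset ι → Finset ι → DecisionTree ι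
  | [], S, N => packGreedily f s S N
  | i :: L, S, N =>
    .attempt i (packList f s L (insert i S) (N.erase i)) (packList f s L S (N.erase i))

/-- Step 1: try the start items of the list, one after the other, until one of them fits. When a
start item `i` fits, continue with Step 2 for the list of items in front of `i` (which is empty if
`i` is not indispensable); when it does not fit, discard all items of at least its size. If no start
item fits, continue with Step 3. -/
def packStartItem (f : Finset ι → ℝ) (s : ι → ℝ) : List ι → Finset ι → DecisionTree ι
  | [], N => packGreedily f s ∅ N
  | i :: F, N =>
    .attempt i (packList f s (isIndispensable f s N i).2 {i} (N.erase i))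
      (packStartItem f s F (N.filter fun j => s j < s i))

/-! The remaining facts only serve to show that no item is attempted twice. -/

theorem packGreedily_noRepeat (f : Finset ι → ℝ) (s : ι → ℝ) (S N X : Finset ι)
    (h : Disjoint N X) : (packGreedily f s S N).NoRepeat X := by
  induction N using Finset.strongInduction generalizing S X with
  | H N ih =>
    rw [packGreedily]
    split_ifs with hN
    · have hm := argmax_mem (density f s S) N hN
      refine ⟨fun hx => disjoint_left.1 h hm hx, ih _ (erase_ssubset hm) _ _ ?_,
        ih (N.filter fun i => s i < s (argmax (density f s S) N hN))
          (filter_ssubset.2 ⟨_, hm, lt_irrefl _⟩) _ _ ?_⟩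
      · rw [disjoint_left] at h ⊢
        intro j hj
        simp only [mem_erase, mem_insert, not_or] at hj ⊢
        exact ⟨hj.1, h hj.2⟩
      · rw [disjoint_left] at h ⊢
        intro j hj
        simp only [mem_filter, mem_insert, not_or] at hj ⊢
        exact ⟨fun e => lt_irrefl _ (e ▸ hj.2), h hj.1⟩
    · trivial

theorem packList_noRepeat (f : Finset ι → ℝ) (s : ι → ℝ) (L : List ι) (S N X : Finset ι)
    (hL : L.Nodup) (hX : ∀ i ∈ L, i ∉ X) (h : Disjoint N X) :
    (packList f s L S N).NoRepeat X := by
  induction L generalizing S N X with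
  | nil => exact packGreedily_noRepeat f s S N X h
  | cons i L ih =>
    rw [List.nodup_cons] at hL
    have hd : Disjoint (N.erase i) (insert i X) := by
      rw [disjoint_left] at h ⊢
      intro j hj
      simp only [mem_erase, mem_insert, not_or] at hj ⊢
      exact ⟨hj.1, h hj.2⟩
    have hX' : ∀ j ∈ L, j ∉ insert i X := by
      intro j hj
      simp only [mem_insert, not_or]
      exact ⟨fun e => hL.1 (e ▸ hj), hX j (List.mem_cons_of_mem _ hj)⟩
    exact ⟨hX i List.mem_cons_self, ih _ _ _ hL.2 hX' hd, ih _ _ _ hL.2 hX' hd⟩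

theorem indispensableLoop_spec (f : Finset ι → ℝ) (s : ι → ℝ) (x : ι) (L : List ι)
    (U W : Finset ι) (hL : L.Nodup) (hx : x ∉ L) (hW : ∀ i ∈ L, i ∈ W) (hU : U ⊆ W)
    (hd : ∀ i ∈ L, i ∉ U) :
    (indispensableLoop f s x L U).2.Nodup ∧ x ∉ (indispensableLoop f s x L U).2 ∧
      ∀ i ∈ (indispensableLoop f s x L U).2, i ∈ W := by
  induction U using Finset.strongInduction generalizing L with
  | H U ih =>
    rw [indispensableLoop]
    split_ifs with h1 h2 h3 h4
    · exact ⟨hL, hx, hW⟩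
    · simp
    · have hm := argmax_mem (density f s L.toFinset) U h1
      refine ih _ (erase_ssubset hm) _ ?_ ?_ ?_ ((erase_subset _ _).trans hU) ?_
      · rw [List.nodup_append]
        refine ⟨hL, List.nodup_singleton _, ?_⟩
        intro a ha b hb e
        rw [List.mem_singleton] at hb
        exact hd a ha (e ▸ hb ▸ hm)
      · simp only [List.mem_append, List.mem_singleton, not_or]
        exact ⟨hx, fun e => h3 e.symm⟩
      · intro i hi
        rcases List.mem_append.1 hi with hi | hi
        · exact hW i hi
        · rw [List.mem_singleton] at hi
          exact hU (hi ▸ hm)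
      · intro i hi hi'
        rcases List.mem_append.1 hi with hi | hi
        · exact hd i hi (mem_of_mem_erase hi')
        · rw [List.mem_singleton] at hi
          exact ne_of_mem_erase hi' hi
    · simp
    · simp

theorem packStartItem_noRepeat (f : Finset ι → ℝ) (s : ι → ℝ) (F : List ι) (N X : Finset ι)
    (hF : F.Nodup) (hX : ∀ i ∈ F, i ∉ X) (h : Disjoint N X) :
    (packStartItem f s F N).NoRepeat X := by
  induction F generalizing N X with
  | nil => exact packGreedily_noRepeat f s ∅ N X h
  | cons i F ih =>
    rw [List.nodup_cons] at hF
    obtain ⟨h1, h2, h3⟩ := indispensableLoop_spec f s i [] (N.filter fun j => s j ≤ s i) N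
      List.nodup_nil (by simp) (by simp) (filter_subset _ _) (by simp)
    refine ⟨hX i List.mem_cons_self, packList_noRepeat f s _ _ _ _ h1 ?_ ?_, ih _ _ hF.2 ?_ ?_⟩
    · intro j hj
      simp only [mem_insert, not_or]
      exact ⟨fun e => h2 (e ▸ hj), disjoint_left.1 h (h3 j hj)⟩
    · rw [disjoint_left] at h ⊢
      intro j hj
      simp only [mem_erase, mem_insert, not_or] at hj ⊢
      exact ⟨hj.1, h hj.2⟩
    · intro j hj
      simp only [mem_insert, not_or]
      exact ⟨fun e => hF.1 (e ▸ hj), hX j (List.mem_cons_of_mem _ hj)⟩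
    · rw [disjoint_left] at h ⊢
      intro j hj
      simp only [mem_filter, mem_insert, not_or] at hj ⊢
      exact ⟨fun e => lt_irrefl _ (e ▸ hj.2), h hj.1⟩

theorem startItemList_nodup (f : Finset ι → ℝ) (s : ι → ℝ) (N : Finset ι) :
    (startItemList f s N).Nodup := by
  have key : ∀ (M F : List ι), M.Nodup → F.Nodup → (∀ i ∈ F, i ∉ M) →
      (M.foldl (addStartItem f s N) F).Nodup := by
    intro M
    induction M with
    | nil => intro F _ hF _; exact hF
    | cons i M ih =>
      intro F hM hF hd
      rw [List.nodup_cons] at hM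
      have hi : i ∉ F := fun hi => hd i hi List.mem_cons_self
      have hd' : ∀ j ∈ F, j ∉ M := fun j hj hj' => hd j hj (List.mem_cons_of_mem _ hj')
      have hc : ∀ j ∈ i :: F, j ∉ M := by
        intro j hj
        rcases List.mem_cons.1 hj with rfl | hj
        · exact hM.1
        · exact hd' j hj
      rw [List.foldl_cons]
      unfold addStartItem
      split_ifs
      · exact ih _ hM.2 (List.nodup_cons.2 ⟨hi, hF⟩) hc
      · exact ih _ hM.2 (List.nodup_cons.2 ⟨hi, hF⟩) hc
      · exact ih _ hM.2 hF hd'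
  refine key _ _ ?_ List.nodup_nil (by simp)
  exact ((List.perm_insertionSort _ _).nodup_iff).2 (N.sort_nodup _)

/-- The robust policy on the item set `N`. -/
def robustPolicy (f : Finset ι → ℝ) (s : ι → ℝ) (N : Finset ι) : Policy ι where
  tree := packStartItem f s (startItemList f s N) N
  noRepeat := packStartItem_noRepeat f s _ _ _ (startItemList_nodup f s N) (by simp) (by simp)

end Knapsack

end

/-!
The items that greedy picks from a set `U` form an increasing sequence `greedySet f s U n`, and this
sequence is unaffected by restricting `U` to a subset that still contains the picked items
(`greedySet_restrict`, `IsNext.restrict`). Fix a capacity `C`. Start items are attempted in order of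
non-increasing size, so that the first one that fits, say `x`, is a largest start item of size at
most `C`, and all items of size at most `C` are still available at that moment
(`packStartItem_pack`). The output of the known-capacity algorithm is either the set `G` packed by
the greedy loop or the first item `y` that does not fit.

If it is `{y}`, then `y` gains more than `f G`. All items of `G` were at least as dense as `y` is now,
so `size s G < s y`; hence the greedy order for the capacity `s y` also starts with `G` followed by
`y`, and `y` is indispensable (`overflow_indispensable`). So `x` exists and `s y ≤ s x`. In the greedy
order for `s x`, the item `x` is either `y` or comes behind `y`; in the latter case `x` is
indispensable and its gain exceeds the value of a set containing `y` (`overflow_le_startItem`).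

If it is `G` and no start item fits, the policy runs greedily from the empty set, and it packs all of
`G`, since a discarded item of size more than `C` takes only larger ones with it
(`packGreedily_superset`). If `x` is packed, the point is that the greedy orders for `C` and for `s x` agree up to and including `x`
(`isNext_startItem`): an item `p` larger than `x` in front of `x` would have a larger gain than
`x` has; if `p` comes first in the order, it is a start item, and otherwise either it is
indispensable, hence a start item, or its gain, and with it that of `x`, is at most the value of the
items in front of `x`. The first two cases contradict that `x` is a largest start item that fits, and
the last one that `x` is indispensable (`size_le_startItem`).
Therefore either the items in front of `x` and `x` itself fit together, and then the policy packs
them and continues like greedy, or the greedy loop stops exactly at `x`,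
whose value exceeds that of the set in front of it.
-/

namespace Knapsack

variable {ι : Type*} [LinearOrder ι] {f : Finset ι → ℝ} {s : ι → ℝ}

/-! ### Submodular set functions, sizes and `argmax` -/

theorem IsSubmodular.gain_anti (hsub : IsSubmodular f) (hmono : Monotone f) {A B : Finset ι}
    (h : A ⊆ B) (x : ι) : f (insert x B) - f B ≤ f (insert x A) - f A := by
  by_cases hx : x ∈ B
  · rw [insert_eq_of_mem hx, sub_self]
    exact sub_nonneg.2 (hmono (subset_insert x A))
  · have h1 := hsub (insert x A) B
    rw [insert_union, union_eq_right.2 h, insert_inter_of_notMem hx, inter_eq_left.2 h] at h1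
    linarith

theorem size_nonneg {ι : Type*} {s : ι → ℝ} (hs : ∀ i, 0 < s i) (A : Finset ι) : 0 ≤ size s A :=
  sum_nonneg fun i _ => (hs i).le

theorem size_insert {A : Finset ι} {i : ι} (h : i ∉ A) : size s (insert i A) = s i + size s A :=
  sum_insert h

theorem size_mono {ι : Type*} {s : ι → ℝ} (hs : ∀ i, 0 < s i) {A B : Finset ι} (h : A ⊆ B) :
    size s A ≤ size s B :=
  sum_le_sum_of_subset_of_nonneg h fun i _ _ => (hs i).le

theorem le_size {ι : Type*} {s : ι → ℝ} (hs : ∀ i, 0 < s i) {A : Finset ι} {i : ι} (h : i ∈ A) :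
    s i ≤ size s A :=
  single_le_sum (fun j _ => (hs j).le) h

theorem le_argmax (g : ι → ℝ) (U : Finset ι) (h : U.Nonempty) {j : ι} (hj : j ∈ U) :
    g j ≤ g (argmax g U h) :=
  (mem_filter.1 ((maximizers g U).min'_mem (maximizers_nonempty g h))).2 j hj

theorem argmax_subset (g : ι → ℝ) {U V : Finset ι} (hVU : V ⊆ U) (hU : U.Nonempty)
    (hV : V.Nonempty) (h : argmax g U hU ∈ V) : argmax g V hV = argmax g U hU := by
  have hmem : argmax g U hU ∈ maximizers g V :=
    mem_filter.2 ⟨h, fun j hj => le_argmax g U hU (hVU hj)⟩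
  refine le_antisymm (min'_le _ _ hmem) (min'_le _ _ (mem_filter.2 ⟨hVU (argmax_mem g V hV), ?_⟩))
  exact fun j hj => (le_argmax g U hU hj).trans (le_argmax g V hV h)

/-! ### The greedy order -/

/-- `a` is the item of `U \ G` that greedy picks when the set `G` is already packed. -/
def IsNext (f : Finset ι → ℝ) (s : ι → ℝ) (U G : Finset ι) (a : ι) : Prop :=
  ∃ h : (U \ G).Nonempty, argmax (density f s G) (U \ G) h = a

theorem IsNext.mem {U G : Finset ι} {a : ι} (h : IsNext f s U G a) : a ∈ U \ G := by
  obtain ⟨h, rfl⟩ := h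
  exact argmax_mem _ _ _

theorem IsNext.unique {U G : Finset ι} {a b : ι} (ha : IsNext f s U G a)
    (hb : IsNext f s U G b) : a = b := by
  obtain ⟨_, rfl⟩ := ha
  obtain ⟨_, rfl⟩ := hb
  rfl

theorem IsNext.density_le {U G : Finset ι} {a b : ι} (ha : IsNext f s U G a) (hb : b ∈ U \ G) :
    density f s G b ≤ density f s G a := by
  obtain ⟨h, rfl⟩ := ha
  exact le_argmax _ _ _ hb

theorem IsNext.restrict {U V G : Finset ι} {a : ι} (ha : IsNext f s U G a) (hVU : V ⊆ U)
    (haV : a ∈ V) : IsNext f s V G a := by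
  have hmem := ha.mem
  obtain ⟨h, rfl⟩ := ha
  have hm := mem_sdiff.2 ⟨haV, (mem_sdiff.1 hmem).2⟩
  exact ⟨⟨_, hm⟩, argmax_subset _ (sdiff_subset_sdiff hVU Subset.rfl) _ _ hm⟩

theorem exists_isNext {U G : Finset ι} (h : (U \ G).Nonempty) : ∃ a, IsNext f s U G a :=
  ⟨_, h, rfl⟩

/-- The set of the first `n` items in the greedy order of `U` (all of `U` if there are fewer). -/
noncomputable def greedySet (f : Finset ι → ℝ) (s : ι → ℝ) (U : Finset ι) : ℕ → Finset ι
  | 0 => ∅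
  | n + 1 =>
    if h : (U \ greedySet f s U n).Nonempty then
      insert (argmax (density f s (greedySet f s U n)) (U \ greedySet f s U n) h)
        (greedySet f s U n)
    else greedySet f s U n

theorem IsNext.greedySet_succ {U : Finset ι} {n : ℕ} {a : ι}
    (h : IsNext f s U (greedySet f s U n) a) :
    greedySet f s U (n + 1) = insert a (greedySet f s U n) := by
  obtain ⟨h, rfl⟩ := h
  rw [greedySet, dif_pos h]

theorem greedySet_mono (U : Finset ι) : Monotone (greedySet f s U) := by
  refine monotone_nat_of_le_succ fun n => ?_
  rw [greedySet]
  split_ifs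
  · exact subset_insert _ _
  · exact le_rfl

theorem greedySet_subset (U : Finset ι) (n : ℕ) : greedySet f s U n ⊆ U := by
  induction n with
  | zero => exact empty_subset U
  | succ n ih =>
    rw [greedySet]
    split_ifs with h
    · exact insert_subset (mem_sdiff.1 (argmax_mem _ _ h)).1 ih
    · exact ih

theorem greedySet_restrict {U V : Finset ι} (hVU : V ⊆ U) {n : ℕ} (h : greedySet f s U n ⊆ V) :
    greedySet f s V n = greedySet f s U n := by
  induction n with
  | zero => rfl
  | succ n ih =>
    have ih := ih ((greedySet_mono U n.le_succ).trans h)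
    by_cases hne : (U \ greedySet f s U n).Nonempty
    · obtain ⟨a, ha⟩ := exists_isNext (f := f) (s := s) hne
      rw [ha.greedySet_succ] at h ⊢
      have ha' := ha.restrict hVU (h (mem_insert_self _ _))
      rw [← ih] at ha'
      rw [ha'.greedySet_succ, ih]
    · have hne' : ¬ (V \ greedySet f s V n).Nonempty := fun h' =>
        hne (ih ▸ h'.mono (sdiff_subset_sdiff hVU Subset.rfl))
      rw [greedySet, greedySet, dif_neg hne, dif_neg hne', ih]

/-- The items in a greedy set were picked with at least the density that an item left over has
afterwards. -/
theorem size_mul_density_le (hs : ∀ i, 0 < s i) (hnorm : f ∅ = 0) (hmono : Monotone f)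
    (hsub : IsSubmodular f) {U : Finset ι} (n : ℕ) {a : ι} (ha : a ∈ U \ greedySet f s U n) :
    size s (greedySet f s U n) * density f s (greedySet f s U n) a ≤ f (greedySet f s U n) := by
  induction n with
  | zero => simp [greedySet, size, hnorm]
  | succ n ih =>
    have hle := greedySet_mono (f := f) (s := s) U n.le_succ
    have ha' := sdiff_subset_sdiff Subset.rfl hle ha
    obtain ⟨b, hb⟩ := exists_isNext (f := f) (s := s) ⟨a, ha'⟩
    have hbn := (mem_sdiff.1 hb.mem).2
    have h1 := ih ha'
    have h2 := hb.density_le ha'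
    have h3 : density f s (greedySet f s U (n + 1)) a ≤ density f s (greedySet f s U n) a :=
      div_le_div_of_nonneg_right (hsub.gain_anti hmono hle a) (hs a).le
    have h4 : s b * density f s (greedySet f s U n) b =
        f (insert b (greedySet f s U n)) - f (greedySet f s U n) :=
      mul_div_cancel₀ _ (hs b).ne'
    rw [hb.greedySet_succ] at h3 ⊢
    rw [size_insert hbn]
    have h5 := mul_le_mul_of_nonneg_left h3 (size_nonneg hs (greedySet f s U n))
    have h6 := mul_le_mul_of_nonneg_left (h3.trans h2) (hs b).le
    linarith

/-! ### The loop of the known-capacity algorithm -/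

theorem greedyLoop_eq_some {γ : ℝ} {U G : Finset ι} {a : ι} (h : IsNext f s U G a)
    (hγ : γ < size s (insert a G)) : greedyLoop f s γ G (U \ G) = (G, some a) := by
  obtain ⟨h, rfl⟩ := h
  rw [greedyLoop, dif_pos h, if_neg hγ.not_ge]

theorem greedyLoop_step {γ : ℝ} {U G : Finset ι} {a : ι} (h : IsNext f s U G a)
    (hγ : size s (insert a G) ≤ γ) :
    greedyLoop f s γ G (U \ G) = greedyLoop f s γ (insert a G) (U \ insert a G) := by
  obtain ⟨h, rfl⟩ := h
  rw [greedyLoop, dif_pos h, if_pos hγ, sdiff_insert]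

/-- The greedy loop runs through every greedy set that fits. -/
theorem greedyLoop_eq_greedyLoop_greedySet (hs : ∀ i, 0 < s i) {γ : ℝ} {U : Finset ι} {n : ℕ}
    (h : size s (greedySet f s U n) ≤ γ) :
    greedyLoop f s γ ∅ U = greedyLoop f s γ (greedySet f s U n) (U \ greedySet f s U n) := by
  induction n with
  | zero => rw [greedySet, sdiff_empty]
  | succ n ih =>
    rw [ih ((size_mono hs (greedySet_mono U n.le_succ)).trans h)]
    by_cases hne : (U \ greedySet f s U n).Nonempty
    · obtain ⟨a, ha⟩ := exists_isNext (f := f) (s := s) hne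
      rw [ha.greedySet_succ] at h ⊢
      exact greedyLoop_step ha h
    · rw [greedySet, dif_neg hne]

theorem greedyLoop_spec_some {γ : ℝ} {U : Finset ι} {a : ι} {n : ℕ} {G : Finset ι}
    (h : greedyLoop f s γ (greedySet f s U n) (U \ greedySet f s U n) = (G, some a)) :
    ∃ m, G = greedySet f s U m ∧ IsNext f s U G a ∧ γ < size s (insert a G) := by
  generalize hk : (U \ greedySet f s U n).card = k
  induction k using Nat.strong_induction_on generalizing n with
  | _ k ih =>
    by_cases hne : (U \ greedySet f s U n).Nonempty
    · obtain ⟨b, hb⟩ := exists_isNext (f := f) (s := s) hne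
      by_cases hγ : size s (insert b (greedySet f s U n)) ≤ γ
      · rw [greedyLoop_step hb hγ, ← hb.greedySet_succ] at h
        refine ih _ ?_ h rfl
        rw [← hk, hb.greedySet_succ, sdiff_insert]
        exact card_erase_lt_of_mem hb.mem
      · rw [greedyLoop_eq_some hb (not_le.1 hγ)] at h
        obtain ⟨rfl, h2⟩ := Prod.mk.inj h
        obtain rfl := Option.some.inj h2
        exact ⟨n, rfl, hb, not_le.1 hγ⟩
    · rw [greedyLoop, dif_neg hne] at h
      simp at h

/-! ### Indispensable items and start items -/

theorem indispensableLoop_cases {x : ι} {U : Finset ι} {n : ℕ} {L : List ι}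
    (hL : L.toFinset = greedySet f s U n) :
    indispensableLoop f s x L (U \ L.toFinset) = (false, []) ∨
      ∃ L' m, indispensableLoop f s x L (U \ L.toFinset) = (true, L') ∧
        L'.toFinset = greedySet f s U m ∧ L' ≠ [] ∧ size s L'.toFinset ≤ s x ∧
        IsNext f s U L'.toFinset x ∧
        f L'.toFinset < f (insert x L'.toFinset) - f L'.toFinset := by
  generalize hk : (U \ L.toFinset).card = k
  induction k using Nat.strong_induction_on generalizing n L with
  | _ k ih =>
    rw [indispensableLoop]
    split_ifs with h1 h2 h3 h4
    · exact Or.inr ⟨L, n, rfl, hL, h4.1, h2, ⟨h1, h3⟩, h4.2⟩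
    · exact Or.inl rfl
    · have hb : IsNext f s U L.toFinset _ := ⟨h1, rfl⟩
      set b := argmax (density f s L.toFinset) (U \ L.toFinset) h1
      have hT : (L ++ [b]).toFinset = insert b L.toFinset := by
        rw [List.toFinset_append, union_comm]; rfl
      have hU : (U \ L.toFinset).erase b = U \ (L ++ [b]).toFinset := by
        rw [hT, sdiff_insert]
      rw [hU]
      refine ih _ ?_ (n := n + 1) ?_ rfl
      · rw [← hU, ← hk]
        exact card_erase_lt_of_mem hb.mem
      · rw [hT]
        rw [hL] at hb ⊢
        exact hb.greedySet_succ.symm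
    · exact Or.inl rfl
    · exact Or.inl rfl

theorem indispensableLoop_eq_true (hs : ∀ i, 0 < s i) {x : ι} {U : Finset ι} {n : ℕ}
    (hne : (greedySet f s U n).Nonempty) (hx : IsNext f s U (greedySet f s U n) x)
    (hsize : size s (greedySet f s U n) ≤ s x)
    (hgain : f (greedySet f s U n) < f (insert x (greedySet f s U n)) - f (greedySet f s U n))
    {L : List ι} {m : ℕ} (hmn : m ≤ n) (hL : L.toFinset = greedySet f s U m) :
    (indispensableLoop f s x L (U \ L.toFinset)).1 = true := by
  induction hmn using Nat.decreasingInduction generalizing L with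
  | self =>
    rw [← hL] at hne hx hsize hgain
    obtain ⟨h, hx⟩ := hx
    have hL0 : L ≠ [] := by
      rintro rfl
      simp at hne
    rw [indispensableLoop, dif_pos h, if_pos hsize, if_pos hx, if_pos ⟨hL0, hgain⟩]
  | of_succ m hmn ih =>
    have hxm := mem_sdiff.1 hx.mem
    have hxm' : x ∈ U \ L.toFinset := by
      rw [hL]
      exact mem_sdiff.2 ⟨hxm.1, fun h => hxm.2 (greedySet_mono U hmn.le h)⟩
    have h1 : (U \ L.toFinset).Nonempty := ⟨x, hxm'⟩
    have h2 : size s L.toFinset ≤ s x := by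
      rw [hL]
      exact (size_mono hs (greedySet_mono U hmn.le)).trans hsize
    have hb : IsNext f s U L.toFinset _ := ⟨h1, rfl⟩
    rw [indispensableLoop, dif_pos h1, if_pos h2]
    set b := argmax (density f s L.toFinset) (U \ L.toFinset) h1
    have hT : (L ++ [b]).toFinset = insert b L.toFinset := by
      rw [List.toFinset_append, union_comm]; rfl
    have hT' : (L ++ [b]).toFinset = greedySet f s U (m + 1) := by
      rw [hT]
      rw [hL] at hb ⊢
      exact hb.greedySet_succ.symm
    have h3 : b ≠ x := by
      rintro h3
      refine hxm.2 (greedySet_mono U (Nat.succ_le_of_lt hmn) ?_)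
      rw [← hT', hT, ← h3]
      exact mem_insert_self _ _
    rw [if_neg h3, ← sdiff_insert, ← hT]
    exact ih hT'

theorem isIndispensable_eq_true (hs : ∀ i, 0 < s i) {x : ι} {N : Finset ι} {n : ℕ}
    (hne : (greedySet f s (N.filter fun i => s i ≤ s x) n).Nonempty)
    (hx : IsNext f s (N.filter fun i => s i ≤ s x)
      (greedySet f s (N.filter fun i => s i ≤ s x) n) x)
    (hsize : size s (greedySet f s (N.filter fun i => s i ≤ s x) n) ≤ s x)
    (hgain : f (greedySet f s (N.filter fun i => s i ≤ s x) n) <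
      f (insert x (greedySet f s (N.filter fun i => s i ≤ s x) n)) -
        f (greedySet f s (N.filter fun i => s i ≤ s x) n)) :
    (isIndispensable f s N x).1 = true := by
  have h := indispensableLoop_eq_true hs hne hx hsize hgain (Nat.zero_le n) (L := []) rfl
  rwa [List.toFinset_nil, sdiff_empty] at h

theorem isFirstItem_iff (hnorm : f ∅ = 0) {N : Finset ι} {x : ι} :
    IsFirstItem f s N x ↔ IsNext f s (N.filter fun i => s i ≤ s x) ∅ x := by
  have h : density f s ∅ = fun i => f {i} / s i := by
    funext i
    simp [density, hnorm]
  simp only [IsNext, IsFirstItem, h, sdiff_empty]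

theorem sortedBySize_pairwise (s : ι → ℝ) (N : Finset ι) :
    (sortedBySize s N).Pairwise fun i j => s i ≤ s j := by
  have : Std.Total fun i j : ι => s i ≤ s j := ⟨fun i j => le_total (s i) (s j)⟩
  have : IsTrans ι fun i j : ι => s i ≤ s j := ⟨fun _ _ _ => le_trans⟩
  exact List.pairwise_insertionSort _ _

theorem mem_sortedBySize {N : Finset ι} {i : ι} : i ∈ sortedBySize s N ↔ i ∈ N := by
  rw [sortedBySize, (List.perm_insertionSort _ _).mem_iff, Finset.mem_sort]

theorem addStartItem_eq_or (N : Finset ι) (F : List ι) (i : ι) :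
    addStartItem f s N F i = i :: F ∨ addStartItem f s N F i = F := by
  unfold addStartItem
  split_ifs <;> simp

theorem subset_foldl_addStartItem (N : Finset ι) (M F : List ι) :
    F ⊆ M.foldl (addStartItem f s N) F := by
  induction M generalizing F with
  | nil => exact List.Subset.refl _
  | cons i M ih =>
    refine List.Subset.trans ?_ (ih _)
    rcases addStartItem_eq_or (f := f) (s := s) N F i with h | h <;> rw [h]
    · exact List.subset_cons_self _ _
    · exact List.Subset.refl _

theorem mem_startItemList_of_isIndispensable {N : Finset ι} {y : ι} (hy : y ∈ N)
    (h : (isIndispensable f s N y).1 = true) : y ∈ startItemList f s N := by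
  obtain ⟨A, B, hAB⟩ := List.append_of_mem (mem_sortedBySize (s := s).2 hy)
  rw [startItemList, hAB, List.foldl_append, List.foldl_cons]
  refine subset_foldl_addStartItem _ _ _ ?_
  rw [addStartItem, if_pos h]
  exact List.mem_cons_self

theorem foldl_addStartItem_subset (N : Finset ι) (M F : List ι) {x : ι}
    (h : x ∈ M.foldl (addStartItem f s N) F) :
    x ∈ F ∨ x ∈ M ∧ ((isIndispensable f s N x).1 = true ∨ IsFirstItem f s N x) := by
  induction M generalizing F with
  | nil => exact Or.inl h
  | cons i M ih =>
    rcases ih _ h with h | ⟨h1, h2⟩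
    · unfold addStartItem at h
      split_ifs at h with h1 h2
      · rcases List.mem_cons.1 h with rfl | h
        · exact Or.inr ⟨List.mem_cons_self, Or.inl h1⟩
        · exact Or.inl h
      · rcases List.mem_cons.1 h with rfl | h
        · exact Or.inr ⟨List.mem_cons_self, Or.inr h2.1⟩
        · exact Or.inl h
      · exact Or.inl h
    · exact Or.inr ⟨List.mem_cons_of_mem _ h1, h2⟩

theorem mem_startItemList {N : Finset ι} {x : ι} (h : x ∈ startItemList f s N) :
    x ∈ N ∧ ((isIndispensable f s N x).1 = true ∨ IsFirstItem f s N x) := by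
  rcases foldl_addStartItem_subset _ _ _ h with h | ⟨h1, h2⟩
  · simp at h
  · exact ⟨mem_sortedBySize.1 h1, h2⟩

/-- Once there is a start item, every larger first item is a start item, too. -/
theorem mem_startItemList_of_isFirstItem {N : Finset ι} {x i : ι} (hx : x ∈ startItemList f s N)
    (hi : i ∈ N) (hxi : s x < s i) (h : IsFirstItem f s N i) : i ∈ startItemList f s N := by
  obtain ⟨A, B, hAB⟩ := List.append_of_mem (mem_sortedBySize (s := s).2 hi)
  have hp := sortedBySize_pairwise s N
  rw [hAB, List.pairwise_append] at hp
  rw [startItemList, hAB, List.foldl_append, List.foldl_cons] at hx ⊢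
  refine subset_foldl_addStartItem _ _ _ ?_
  rcases foldl_addStartItem_subset _ _ _ hx with hx | ⟨hx, -⟩
  · unfold addStartItem at hx ⊢
    split_ifs at hx ⊢ with h1 h2
    · exact List.mem_cons_self
    · exact List.mem_cons_self
    · exact absurd ⟨h, List.ne_nil_of_mem hx⟩ h2
  · exact absurd ((List.pairwise_cons.1 hp.2.1).1 x hx) hxi.not_ge

theorem startItemList_pairwise (f : Finset ι → ℝ) (s : ι → ℝ) (N : Finset ι) :
    (startItemList f s N).Pairwise fun i j => s j ≤ s i := by
  have key : ∀ M F : List ι, M.Pairwise (fun i j => s i ≤ s j) →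
      F.Pairwise (fun i j => s j ≤ s i) → (∀ i ∈ F, ∀ j ∈ M, s i ≤ s j) →
      (M.foldl (addStartItem f s N) F).Pairwise fun i j => s j ≤ s i := by
    intro M
    induction M with
    | nil => exact fun F _ hF _ => hF
    | cons i M ih =>
      intro F hM hF hFM
      rw [List.pairwise_cons] at hM
      have hFM' : ∀ a ∈ F, ∀ j ∈ M, s a ≤ s j := fun a ha j hj =>
        hFM a ha j (List.mem_cons_of_mem _ hj)
      rw [List.foldl_cons]
      rcases addStartItem_eq_or (f := f) (s := s) N F i with h | h <;> rw [h]
      · refine ih _ hM.2 (List.pairwise_cons.2 ⟨fun a ha => hFM a ha i List.mem_cons_self, hF⟩) ?_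
        intro a ha j hj
        rcases List.mem_cons.1 ha with rfl | ha
        · exact hM.1 j hj
        · exact hFM' a ha j hj
      · exact ih _ hM.2 hF hFM'
  exact key _ _ (sortedBySize_pairwise s N) List.Pairwise.nil (by simp)

/-- A start item `x` comes right behind the items of its list in the greedy order for the capacity
`s x`, whether it is indispensable or the first item of that order. -/
theorem startItem_spec (hs : ∀ i, 0 < s i) (hnorm : f ∅ = 0) {N : Finset ι} {x : ι}
    (hx : x ∈ startItemList f s N) :
    ∃ n, (isIndispensable f s N x).2.toFinset = greedySet f s (N.filter fun i => s i ≤ s x) n ∧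
      IsNext f s (N.filter fun i => s i ≤ s x)
        (greedySet f s (N.filter fun i => s i ≤ s x) n) x ∧
      size s (greedySet f s (N.filter fun i => s i ≤ s x) n) ≤ s x ∧
      (n ≠ 0 → f (greedySet f s (N.filter fun i => s i ≤ s x) n) <
        f (insert x (greedySet f s (N.filter fun i => s i ≤ s x) n)) -
          f (greedySet f s (N.filter fun i => s i ≤ s x) n)) := by
  have hcases := indispensableLoop_cases (f := f) (s := s) (x := x)
    (U := N.filter fun i => s i ≤ s x) (n := 0) (L := []) rfl
  rw [List.toFinset_nil, sdiff_empty] at hcases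
  change isIndispensable f s N x = _ ∨ ∃ L' m, isIndispensable f s N x = _ ∧ _ at hcases
  rcases hcases with h | ⟨L, m, h, hL, -, h2, h3, h4⟩
  · rcases (mem_startItemList hx).2 with h' | h'
    · simp [h] at h'
    · refine ⟨0, by simp [h, greedySet], (isFirstItem_iff hnorm).1 h', ?_, fun h => absurd rfl h⟩
      simpa [greedySet, size] using (hs x).le
  · rw [hL] at h2 h3 h4
    exact ⟨m, by rw [h, hL], h3, h2, fun _ => h4⟩

/-! ### The sets packed by the policy -/

/-- As long as everything that greedy with capacity `C` picks fits, Step 3 packs the same items: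
an item of size more than `C` is discarded without discarding items of size at most `C`. -/
theorem packGreedily_superset (hs : ∀ i, 0 < s i) {C : ℝ} (S M : Finset ι) (hSM : Disjoint M S) :
    (greedyLoop f s C S (M.filter fun i => s i ≤ C)).1 ⊆
      S ∪ (packGreedily f s S M).pack s (C - size s S) := by
  induction M using Finset.strongInduction generalizing S with
  | H M ih =>
    by_cases hM : M.Nonempty
    · have hm := argmax_mem (density f s S) M hM
      rw [packGreedily, dif_pos hM, DecisionTree.pack]
      generalize hz : argmax (density f s S) M hM = z at hm
      have hzS : z ∉ S := disjoint_left.1 hSM hm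
      by_cases hzC : s z ≤ C
      · have hmem : z ∈ M.filter fun i => s i ≤ C := mem_filter.2 ⟨hm, hzC⟩
        have hne : (M.filter fun i => s i ≤ C).Nonempty := ⟨z, hmem⟩
        have harg : argmax (density f s S) (M.filter fun i => s i ≤ C) hne = z := by
          rw [← hz]
          exact argmax_subset _ (filter_subset _ _) hM hne (hz ▸ hmem)
        rw [greedyLoop, dif_pos hne, harg, size_insert hzS]
        split_ifs with h1 h2 h2
        · have hd : Disjoint (M.erase z) (insert z S) := by
            rw [disjoint_insert_right]
            exact ⟨notMem_erase _ _, hSM.mono_left (erase_subset _ _)⟩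
          have h := ih _ (erase_ssubset hm) (insert z S) hd
          rw [size_insert hzS, ← sub_sub, sub_right_comm] at h
          rw [← filter_erase, union_insert, ← insert_union]
          exact h
        · linarith
        · linarith
        · exact subset_union_left
      · have hfit : ¬ s z ≤ C - size s S := by linarith [size_nonneg hs S]
        have hfil : (M.filter fun i => s i ≤ C) =
            (M.filter fun i => s i < s z).filter fun i => s i ≤ C := by
          rw [filter_filter]
          refine filter_congr fun i _ => ⟨fun h => ⟨?_, h⟩, fun h => h.2⟩
          linarith
        rw [if_neg hfit, hfil]
        exact ih (M.filter fun i => s i < s z) (filter_ssubset.2 ⟨z, hm, lt_irrefl _⟩) S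
          (hSM.mono_left (filter_subset _ _))
    · rw [not_nonempty_iff_eq_empty.1 hM, filter_empty, greedyLoop, dif_neg Finset.not_nonempty_empty]
      exact subset_union_left

/-- If all items of the list fit, Step 2 packs them all. -/
theorem packList_pack (hs : ∀ i, 0 < s i) {C : ℝ} (L : List ι) (S M : Finset ι) (hL : L.Nodup)
    (hd : ∀ i ∈ L, i ∉ S) (hC : size s (S ∪ L.toFinset) ≤ C) :
    S ∪ (packList f s L S M).pack s (C - size s S) =
      (S ∪ L.toFinset) ∪ (packGreedily f s (S ∪ L.toFinset) (M \ L.toFinset)).pack s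
        (C - size s (S ∪ L.toFinset)) := by
  induction L generalizing S M with
  | nil => simp [packList]
  | cons i L ih =>
    have hi := hd i List.mem_cons_self
    rw [List.nodup_cons] at hL
    have hU : S ∪ (i :: L).toFinset = insert i S ∪ L.toFinset := by
      rw [List.toFinset_cons, union_insert, insert_union]
    have hM : M \ (i :: L).toFinset = M.erase i \ L.toFinset := by
      rw [List.toFinset_cons, sdiff_insert, erase_sdiff_comm]
    rw [hU] at hC
    have h1 := (size_mono hs (subset_union_left (s₂ := L.toFinset))).trans hC
    have h2 : size s (insert i S) = s i + size s S := size_insert hi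
    rw [packList, DecisionTree.pack, if_pos (by linarith), hU, hM, union_insert, ← insert_union,
      show C - size s S - s i = C - size s (insert i S) by linarith]
    refine ih _ _ hL.2 (fun j hj => ?_) hC
    rw [mem_insert, not_or]
    exact ⟨fun e => hL.1 (e ▸ hj), hd j (List.mem_cons_of_mem _ hj)⟩

/-- Step 1 either finds no start item that fits, or stops at a largest start item that fits; the
items that are available then include all items of size at most `C`. -/
theorem packStartItem_pack {N : Finset ι} {C : ℝ} (F : List ι) (M : Finset ι) (hMN : M ⊆ N)
    (hM : ∀ i ∈ N, s i ≤ C → i ∈ M) (hF : F.Pairwise fun i j => s j ≤ s i) :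
    ∃ M' ⊆ N, (∀ i ∈ N, s i ≤ C → i ∈ M') ∧
      (((∀ i ∈ F, C < s i) ∧
          (packStartItem f s F M).pack s C = (packGreedily f s ∅ M').pack s C) ∨
        ∃ x ∈ F, s x ≤ C ∧ (∀ i ∈ F, s i ≤ C → s i ≤ s x) ∧
          (packStartItem f s F M).pack s C =
            insert x ((packList f s (isIndispensable f s M' x).2 {x} (M'.erase x)).pack s
              (C - s x))) := by
  induction F generalizing M with
  | nil => exact ⟨M, hMN, hM, Or.inl ⟨by simp, rfl⟩⟩
  | cons a F ih =>
    rw [List.pairwise_cons] at hF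
    by_cases ha : s a ≤ C
    · refine ⟨M, hMN, hM, Or.inr ⟨a, List.mem_cons_self, ha, fun i hi _ => ?_, ?_⟩⟩
      · rcases List.mem_cons.1 hi with rfl | hi
        · exact le_rfl
        · exact hF.1 i hi
      · rw [packStartItem, DecisionTree.pack, if_pos ha]
    · obtain ⟨M', h1, h2, h3⟩ := ih (M.filter fun j => s j < s a)
        ((filter_subset _ _).trans hMN)
        (fun i hi hiC => mem_filter.2 ⟨hM i hi hiC, hiC.trans_lt (not_le.1 ha)⟩) hF.2
      refine ⟨M', h1, h2, ?_⟩
      rw [packStartItem, DecisionTree.pack, if_neg ha]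
      rcases h3 with ⟨h3, h4⟩ | ⟨x, hx, h3, h4, h5⟩
      · refine Or.inl ⟨fun i hi => ?_, h4⟩
        rcases List.mem_cons.1 hi with rfl | hi
        · exact not_le.1 ha
        · exact h3 i hi
      · refine Or.inr ⟨x, List.mem_cons_of_mem _ hx, h3, fun i hi hiC => ?_, h5⟩
        rcases List.mem_cons.1 hi with rfl | hi
        · exact absurd hiC ha
        · exact h4 i hi hiC

/-! ### Comparing the policy with the known-capacity algorithm -/

section Compare

variable (hs : ∀ i, 0 < s i) (hnorm : f ∅ = 0) (hmono : Monotone f) (hsub : IsSubmodular f)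
  {N : Finset ι} {C : ℝ}

include hs hnorm hmono hsub

/-- An item that overflows the capacity and gains more than the value of the greedy set in front of
it is indispensable: its density is at most the average density of that set, so that set is
smaller than the item. -/
theorem overflow_indispensable {k : ℕ} {y : ι}
    (hy : IsNext f s (N.filter fun i => s i ≤ C) (greedySet f s (N.filter fun i => s i ≤ C) k) y)
    (hC : C < size s (insert y (greedySet f s (N.filter fun i => s i ≤ C) k)))
    (hgain : f (greedySet f s (N.filter fun i => s i ≤ C) k) <
      f (insert y (greedySet f s (N.filter fun i => s i ≤ C) k)) -
        f (greedySet f s (N.filter fun i => s i ≤ C) k)) :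
    size s (greedySet f s (N.filter fun i => s i ≤ C) k) < s y ∧
      (isIndispensable f s N y).1 = true := by
  set U := N.filter fun i => s i ≤ C
  have hyU := mem_sdiff.1 hy.mem
  have hyN := mem_filter.1 hyU.1
  have h1 := size_mul_density_le hs hnorm hmono hsub k hy.mem
  set G := greedySet f s U k with hG
  have hf0 : 0 ≤ f G := hnorm ▸ hmono (empty_subset G)
  have hsize : size s G < s y := by
    by_contra! h
    -- otherwise `s y * density ≤ size * density ≤ f G`, where the left side is the gain of `y`
    have hd : 0 ≤ density f s G y := div_nonneg (by linarith) (hs y).le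
    have h2 : s y * density f s G y = f (insert y G) - f G := mul_div_cancel₀ _ (hs y).ne'
    linarith [mul_le_mul_of_nonneg_right h hd]
  refine ⟨hsize, ?_⟩
  have hVU : (N.filter fun i => s i ≤ s y) ⊆ U := fun i hi =>
    mem_filter.2 ⟨(mem_filter.1 hi).1, (mem_filter.1 hi).2.trans hyN.2⟩
  have hGV : G ⊆ N.filter fun i => s i ≤ s y := fun i hi =>
    mem_filter.2 ⟨(mem_filter.1 (greedySet_subset U k hi)).1, (le_size hs hi).trans hsize.le⟩
  have hGe := greedySet_restrict hVU hGV
  have hne : G.Nonempty := by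
    rw [nonempty_iff_ne_empty]
    intro h
    rw [h] at hC
    simp [size] at hC
    linarith [hyN.2]
  refine isIndispensable_eq_true hs (n := k) ?_ ?_ ?_ ?_ <;> rw [hGe]
  · exact hne
  · exact hy.restrict hVU (mem_filter.2 ⟨hyN.1, le_rfl⟩)
  · exact hsize.le
  · exact hgain

/-- A start item that is at least as large as the item `y` that greedy picks behind a greedy set
smaller than `y` is at least as valuable as `y`. -/
theorem overflow_le_startItem {k : ℕ} {x y : ι}
    (hy : IsNext f s (N.filter fun i => s i ≤ C) (greedySet f s (N.filter fun i => s i ≤ C) k) y)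
    (hsize : size s (greedySet f s (N.filter fun i => s i ≤ C) k) < s y)
    (hx : x ∈ startItemList f s N) (hxC : s x ≤ C) (hyx : s y ≤ s x) : f {y} ≤ f {x} := by
  obtain ⟨n, -, hnext, -, hgain⟩ := startItem_spec hs hnorm hx
  set U := N.filter fun i => s i ≤ C
  set V := N.filter fun i => s i ≤ s x
  have hyN := mem_filter.1 (mem_sdiff.1 hy.mem).1
  have hVU : V ⊆ U := fun i hi =>
    mem_filter.2 ⟨(mem_filter.1 hi).1, (mem_filter.1 hi).2.trans hxC⟩
  have hGV : greedySet f s U k ⊆ V := fun i hi => mem_filter.2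
    ⟨(mem_filter.1 (greedySet_subset U k hi)).1, (le_size hs hi).trans (hsize.le.trans hyx)⟩
  have hGe := greedySet_restrict hVU hGV
  have hyV := hy.restrict hVU (mem_filter.2 ⟨hyN.1, hyx⟩)
  rw [← hGe] at hyV hsize
  rcases lt_trichotomy n k with hnk | rfl | hnk
  · have hxk : x ∈ greedySet f s V k := greedySet_mono V (Nat.succ_le_of_lt hnk) (by
      rw [hnext.greedySet_succ]
      exact mem_insert_self _ _)
    linarith [le_size hs hxk]
  · rw [hnext.unique hyV]
  · have hyn : {y} ⊆ greedySet f s V n := by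
      rw [singleton_subset_iff]
      refine greedySet_mono V (Nat.succ_le_of_lt hnk) ?_
      rw [hyV.greedySet_succ]
      exact mem_insert_self _ _
    have h1 := hmono hyn
    have h2 := hgain (by lia)
    have h3 := hsub.gain_anti hmono (empty_subset (greedySet f s V n)) x
    rw [insert_empty_eq, hnorm] at h3
    linarith

/-- In front of the largest start item `x` that fits, the greedy order for the capacity `C` does
not contain an item larger than `x`. -/
theorem size_le_startItem {x p : ι} {n m : ℕ}
    (hx : x ∈ startItemList f s N) (hxC : s x ≤ C)
    (hmax : ∀ i ∈ startItemList f s N, s i ≤ C → s i ≤ s x)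
    (hnext : IsNext f s (N.filter fun i => s i ≤ s x)
      (greedySet f s (N.filter fun i => s i ≤ s x) n) x)
    (hsize : size s (greedySet f s (N.filter fun i => s i ≤ s x) n) ≤ s x)
    (hgain : n ≠ 0 → f (greedySet f s (N.filter fun i => s i ≤ s x) n) <
      f (insert x (greedySet f s (N.filter fun i => s i ≤ s x) n)) -
        f (greedySet f s (N.filter fun i => s i ≤ s x) n))
    (hmn : m ≤ n)
    (heq : greedySet f s (N.filter fun i => s i ≤ C) m =
      greedySet f s (N.filter fun i => s i ≤ s x) m)
    (hp : IsNext f s (N.filter fun i => s i ≤ C)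
      (greedySet f s (N.filter fun i => s i ≤ C) m) p) : s p ≤ s x := by
  by_contra! hxp
  set U := N.filter fun i => s i ≤ C
  set V := N.filter fun i => s i ≤ s x
  have hpN := mem_filter.1 (mem_sdiff.1 hp.mem).1
  have hpF : p ∉ startItemList f s N := fun h => (hmax p h hpN.2).not_gt hxp
  have hWU : (N.filter fun i => s i ≤ s p) ⊆ U := fun i hi =>
    mem_filter.2 ⟨(mem_filter.1 hi).1, (mem_filter.1 hi).2.trans hpN.2⟩
  have hpW := hp.restrict hWU (mem_filter.2 ⟨hpN.1, le_rfl⟩)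
  have hVU : V ⊆ U := fun i hi =>
    mem_filter.2 ⟨(mem_filter.1 hi).1, (mem_filter.1 hi).2.trans hxC⟩
  have hxm : x ∈ V \ greedySet f s V m :=
    sdiff_subset_sdiff Subset.rfl (greedySet_mono V hmn) hnext.mem
  rcases Nat.eq_zero_or_pos m with rfl | hm
  · exact hpF (mem_startItemList_of_isFirstItem hx hpN.1 hxp ((isFirstItem_iff hnorm).2 hpW))
  · have hGW : greedySet f s U m ⊆ N.filter fun i => s i ≤ s p := by
      rw [heq]
      exact fun i hi => mem_filter.2 ⟨(mem_filter.1 (greedySet_subset V m hi)).1,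
        (mem_filter.1 (greedySet_subset V m hi)).2.trans hxp.le⟩
    have hGe := greedySet_restrict hWU hGW
    have hle := greedySet_mono (f := f) (s := s) V hmn
    have hne : (greedySet f s U m).Nonempty := by
      rw [heq]
      obtain ⟨b, hb⟩ := exists_isNext (f := f) (s := s) (U := V) (G := greedySet f s V 0)
        ⟨x, sdiff_subset_sdiff Subset.rfl (greedySet_mono V hm.le) hxm⟩
      refine ⟨b, greedySet_mono V (Nat.succ_le_of_lt hm) ?_⟩
      rw [hb.greedySet_succ]
      exact mem_insert_self _ _
    have hnot : f (insert p (greedySet f s U m)) - f (greedySet f s U m) ≤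
        f (greedySet f s U m) := by
      by_contra! h
      refine hpF (mem_startItemList_of_isIndispensable hpN.1
        (isIndispensable_eq_true hs (n := m) ?_ ?_ ?_ ?_)) <;> rw [hGe]
      · exact hne
      · exact hpW
      · rw [heq]
        exact (size_mono hs hle).trans (hsize.trans hxp.le)
      · exact h
    rw [heq] at hnot hp
    have h1 := hgain (by lia)
    have h2 := hsub.gain_anti hmono hle x
    have h3 := hmono hle
    have hdens := hp.density_le (sdiff_subset_sdiff hVU Subset.rfl hxm)
    have h0 : 0 ≤ f (greedySet f s V n) := hnorm ▸ hmono (empty_subset _)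
    -- the gain of `p` exceeds that of `x`, as `p` is larger and at least as dense; but the gain of `p`
    -- is at most the value of the items in front of it, and so less than the gain of `x`
    unfold density at hdens
    rw [div_le_div_iff₀ (hs x) (hs p)] at hdens
    nlinarith [hs x, hs p]

/-- The greedy orders for the capacity `C` and for the capacity `s x` agree up to and including
the largest start item `x` that fits. -/
theorem isNext_startItem {x : ι} {n : ℕ}
    (hx : x ∈ startItemList f s N) (hxC : s x ≤ C)
    (hmax : ∀ i ∈ startItemList f s N, s i ≤ C → s i ≤ s x)
    (hnext : IsNext f s (N.filter fun i => s i ≤ s x)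
      (greedySet f s (N.filter fun i => s i ≤ s x) n) x)
    (hsize : size s (greedySet f s (N.filter fun i => s i ≤ s x) n) ≤ s x)
    (hgain : n ≠ 0 → f (greedySet f s (N.filter fun i => s i ≤ s x) n) <
      f (insert x (greedySet f s (N.filter fun i => s i ≤ s x) n)) -
        f (greedySet f s (N.filter fun i => s i ≤ s x) n)) :
    greedySet f s (N.filter fun i => s i ≤ C) n =
        greedySet f s (N.filter fun i => s i ≤ s x) n ∧
      IsNext f s (N.filter fun i => s i ≤ C) (greedySet f s (N.filter fun i => s i ≤ C) n) x := by
  have hp := fun m hmn heq p => size_le_startItem (m := m) (p := p) hs hnorm hmono hsub hx hxC hmax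
    hnext hsize hgain hmn heq
  set U := N.filter fun i => s i ≤ C
  set V := N.filter fun i => s i ≤ s x
  have hVU : V ⊆ U := fun i hi =>
    mem_filter.2 ⟨(mem_filter.1 hi).1, (mem_filter.1 hi).2.trans hxC⟩
  have step : ∀ m ≤ n, greedySet f s U m = greedySet f s V m →
      ∃ p, IsNext f s U (greedySet f s U m) p ∧ IsNext f s V (greedySet f s V m) p := by
    intro m hmn heq
    have hxm : x ∈ U \ greedySet f s U m := by
      rw [heq]
      exact sdiff_subset_sdiff hVU (greedySet_mono V hmn) hnext.mem
    obtain ⟨p, hpU⟩ := exists_isNext (f := f) (s := s) ⟨x, hxm⟩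
    have hpN := mem_filter.1 (mem_sdiff.1 hpU.mem).1
    refine ⟨p, hpU, ?_⟩
    have h := hpU.restrict hVU (mem_filter.2 ⟨hpN.1, hp m hmn heq p hpU⟩)
    rwa [heq] at h
  have hall : ∀ m ≤ n, greedySet f s U m = greedySet f s V m := by
    intro m
    induction m with
    | zero => exact fun _ => rfl
    | succ m ih =>
      intro hmn
      have heq := ih (by lia)
      obtain ⟨p, h1, h2⟩ := step m (by lia) heq
      rw [h1.greedySet_succ, h2.greedySet_succ, heq]
  refine ⟨hall n le_rfl, ?_⟩
  obtain ⟨p, h1, h2⟩ := step n le_rfl (hall n le_rfl)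
  rwa [h2.unique hnext] at h1

/-- If a start item is packed first, the policy packs a set at least as good as the one packed by the
greedy loop that knows the capacity. -/
theorem greedyLoop_le_of_startItem {M : Finset ι} {x : ι} (hMN : M ⊆ N)
    (hM : ∀ i ∈ N, s i ≤ C → i ∈ M)
    (hx : x ∈ startItemList f s N) (hxC : s x ≤ C)
    (hmax : ∀ i ∈ startItemList f s N, s i ≤ C → s i ≤ s x) :
    f (greedyLoop f s C ∅ (N.filter fun i => s i ≤ C)).1 ≤
      f (insert x ((packList f s (isIndispensable f s M x).2 {x} (M.erase x)).pack s
        (C - s x))) := by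
  have hfil : ∀ γ ≤ C, (M.filter fun i => s i ≤ γ) = N.filter fun i => s i ≤ γ := by
    intro γ hγ
    ext i
    simp only [mem_filter]
    exact ⟨fun h => ⟨hMN h.1, h.2⟩, fun h => ⟨hM i h.1 (h.2.trans hγ), h.2⟩⟩
  obtain ⟨n, hL, hnext, hsize, hgain⟩ := startItem_spec hs hnorm hx
  obtain ⟨heq, hnextU⟩ := isNext_startItem hs hnorm hmono hsub hx hxC hmax hnext hsize hgain
  have hind : isIndispensable f s M x = isIndispensable f s N x := by
    rw [isIndispensable, isIndispensable, hfil _ hxC]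
  rw [hind]
  obtain ⟨hnd, hxL, -⟩ := indispensableLoop_spec f s x [] (N.filter fun j => s j ≤ s x) N
    List.nodup_nil (by simp) (by simp) (filter_subset _ _) (by simp)
  change (isIndispensable f s N x).2.Nodup at hnd
  change x ∉ (isIndispensable f s N x).2 at hxL
  generalize (isIndispensable f s N x).2 = L at hL hnd hxL ⊢
  rw [← heq] at hL hsize hgain
  rw [greedyLoop_eq_greedyLoop_greedySet hs (hsize.trans hxC)]
  have hUeq := hfil C le_rfl
  set U := N.filter fun i => s i ≤ C
  set G := greedySet f s U n with hG
  by_cases hfit : size s (insert x G) ≤ C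
  · rw [greedyLoop_step hnextU hfit]
    have hS : {x} ∪ L.toFinset = insert x G := by rw [hL, singleton_union]
    have hpack := packList_pack (f := f) hs (C := C) L {x} (M.erase x) hnd
      (fun i hi h => hxL (mem_singleton.1 h ▸ hi)) (by rwa [hS])
    have hrest : M.erase x \ L.toFinset = M \ insert x G := by
      rw [hL, sdiff_insert, erase_sdiff_comm]
    have hx1 : size s {x} = s x := sum_singleton _ _
    rw [hS, hrest, hx1, singleton_union] at hpack
    rw [hpack]
    have hU' : U \ insert x G = (M \ insert x G).filter fun i => s i ≤ C := by
      rw [← hUeq]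
      ext i
      simp only [mem_sdiff, mem_filter]
      tauto
    rw [hU']
    exact hmono (packGreedily_superset hs _ _ sdiff_disjoint)
  · -- the greedy loop stops with `G`, whose value is less than that of `x`
    rw [greedyLoop_eq_some hnextU (not_le.1 hfit)]
    have hn : n ≠ 0 := by
      rintro rfl
      apply hfit
      simpa [hG, greedySet, size] using hxC
    have h1 := hgain hn
    have h2 := hsub.gain_anti hmono (empty_subset G) x
    rw [insert_empty_eq, hnorm] at h2
    have h3 : f {x} ≤ f (insert x ((packList f s L {x} (M.erase x)).pack s (C - s x))) :=
      hmono (singleton_subset_iff.2 (mem_insert_self _ _))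
    have h0 : 0 ≤ f G := hnorm ▸ hmono (empty_subset _)
    change f G ≤ _
    linarith

theorem aGreedy_le_robustPolicy :
    f (aGreedy f s N C) ≤ f ((robustPolicy f s N).pack s C) := by
  change _ ≤ f ((packStartItem f s (startItemList f s N) N).pack s C)
  obtain ⟨M, hMN, hM, hcase⟩ := packStartItem_pack (f := f) (startItemList f s N) N Subset.rfl
    (C := C) (fun i hi _ => hi) (startItemList_pairwise f s N)
  have hloop : f (greedyLoop f s C ∅ (N.filter fun i => s i ≤ C)).1 ≤
      f ((packStartItem f s (startItemList f s N) N).pack s C) := by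
    rcases hcase with ⟨-, h⟩ | ⟨x, hx, hxC, hmax, h⟩
    · have hU : (N.filter fun i => s i ≤ C) = M.filter fun i => s i ≤ C := by
        ext i
        simp only [mem_filter]
        exact ⟨fun h => ⟨hM i h.1 h.2, h.2⟩, fun h => ⟨hMN h.1, h.2⟩⟩
      have hsup := packGreedily_superset (f := f) hs (C := C) ∅ M (disjoint_empty_right _)
      have h0 : size s ∅ = 0 := sum_empty
      rw [empty_union, h0, sub_zero] at hsup
      rw [h, hU]
      exact hmono hsup
    · rw [h]
      exact greedyLoop_le_of_startItem hs hnorm hmono hsub hMN hM hx hxC hmax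
  unfold aGreedy
  split
  · rename_i G hG
    rwa [hG] at hloop
  · rename_i G y hG
    rw [hG] at hloop
    split_ifs with hgain
    · exact hloop
    · have hspec := greedyLoop_spec_some (f := f) (s := s) (γ := C) (n := 0) (G := G) (a := y)
        (U := N.filter fun i => s i ≤ C) (by rwa [greedySet, sdiff_empty])
      obtain ⟨k, rfl, hy, hyC⟩ := hspec
      obtain ⟨hsize, hind⟩ := overflow_indispensable hs hnorm hmono hsub hy hyC (not_le.1 hgain)
      have hyN := mem_filter.1 (mem_sdiff.1 hy.mem).1
      have hyF := mem_startItemList_of_isIndispensable hyN.1 hind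
      rcases hcase with ⟨h, -⟩ | ⟨x, hx, hxC, hmax, h⟩
      · exact absurd hyN.2 (h y hyF).not_ge
      · refine (overflow_le_startItem hs hnorm hmono hsub hy hsize hx hxC
          (hmax y hyF hyN.2)).trans (hmono ?_)
        rw [h]
        exact singleton_subset_iff.2 (mem_insert_self _ _)

end Compare

end Knapsack

theorem mainTheorem2 {ι : Type*} [Fintype ι] [LinearOrder ι] (s : ι → ℝ) (hs : ∀ i, 0 < s i)
    (f : Finset ι → ℝ) (hnorm : f ∅ = 0) (hmono : Monotone f) (hsub : Knapsack.IsSubmodular f) :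
    ∀ C : ℝ, 0 < C →
      f (Knapsack.aGreedy f s Finset.univ C) ≤
        f ((Knapsack.robustPolicy f s Finset.univ).pack s C) :=
  fun _ _ => Knapsack.aGreedy_le_robustPolicy hs hnorm hmono hsub
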